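/- Let $(M,g)$ be a Kähler manifold of complex dimension $n$. A pointed stable graph $\Gamma=(V\cup\{f\},E)$ is a finite directed graph (loops and multiple edges allowed) with a distinguished vertex $f$, such that every ordinary vertex $v\in V$ has indegree at least $2$ and outdegree at least $2$. Let $\dot{\mathcal G}_{scon}$ be the set of isomorphism classes (fixing $f$) of strongly connected pointed stable graphs; $\dot{\rm Aut}(\Gamma)$ is the group of automorphisms of $\Gamma$ fixing $f$ (parallel edges may be permuted), $\Gamma_-$ is the graph obtained by removing $f$ from $\Gamma$, and $A(\Gamma_-)$ is its adjacency matrix. Fix holomorphic normal coordinates around each point $x\in M$: $g_{i\bar j}(x)=\delta_{ij}$ and $g_{i\bar j k_1\cdots k_r}(x)=g_{i\bar j\bar l_1\cdots\bar l_r}(x)=0$ for $1\le r\le N$, where subscripts after $g_{i\bar j}$ denote partial derivatives and, for the coefficient of $h^k$ below, $N\geq 4k$. The partition function $D_\Gamma(f_1,f_2)$ at $x$ is defined as follows: attach to each edge an index in $\{1,\dots,n\}$, unbarred at its source and barred at its target; each $v\in V$ contributes the partial derivative $g_{i_1\bar j_1 i_2\cdots i_p\bar j_2\cdots\bar j_q}(x)$,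 where $i_1,\dots,i_p$ are the indices of its outgoing edges and $j_1,\dots,j_q$ those of its incoming edges; $f$ contributes $(\bar\partial_{j_1}\cdots\bar\partial_{j_b}f_1)(x)\,(\partial_{i_1}\cdots\partial_{i_a}f_2)(x)$, where $j_1,\dots,j_b$ are the indices of the edges entering $f$ and $i_1,\dots,i_a$ those of the edges leaving $f$; multiply all contributions and sum over all indices. The Berezin star product of $f_1,f_2\in C^\infty(M)$ (complex-valued) is the formal power series in $h$ given at each $x$ by $$ (f_1\star f_2)(x)=\sum_{\Gamma\in\dot{\mathcal G}_{scon}}\frac{\det(A(\Gamma_-)-I)}{|\dot{\rm Aut}(\Gamma)|}\,h^{|E|-|V|}\,D_\Gamma(f_1,f_2)\Big|_x ,$$ extended $h$-bilinearly to formal power series in $h$ with coefficients in $C^\infty(M)$. **Proposition (conjugation symmetry).** For all $f_1,f_2\in C^\infty(M)$, $$\overline{f_1\star f_2}=\overline{f_2}\star\overline{f_1},$$ where conjugation acts coefficientwise on power series in $h$ (that is, $\bar h=h$). The same identity holds for formal power series $f_1,f_2\in C^\infty(M)[[h]]$. -/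

import Mathlib

open scoped Manifold ContDiff ComplexConjugate

namespace Berezin

/-! ### Pointed digraphs -/

/-- A finite digraph with one distinguished vertex `f`; loops and multiple edges are allowed.
The ordinary vertices are `some v` with `v : Fin nV`, the distinguished vertex is `none`;
the edges are indexed by `Fin nE`, the edge `a` going from `src a` to `tgt a`. -/
structure PointedDigraph where
  nV : ℕ
  nE : ℕ
  src : Fin nE → Option (Fin nV)
  tgt : Fin nE → Option (Fin nV)

namespace PointedDigraph

/-- An isomorphism of pointed digraphs: a bijection of the ordinary vertices and a bijection of
the edges, compatible with sources and targets, the distinguished vertex going to the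
distinguished vertex. -/
@[ext]
structure Iso (Γ Γ' : PointedDigraph) where
  vert : Fin Γ.nV ≃ Fin Γ'.nV
  edge : Fin Γ.nE ≃ Fin Γ'.nE
  src_edge : ∀ a, Γ'.src (edge a) = (Γ.src a).map vert
  tgt_edge : ∀ a, Γ'.tgt (edge a) = (Γ.tgt a).map vert

/-- The number of automorphisms of a pointed digraph. Parallel edges may be permuted, so that the
graph with `k` loops at the distinguished vertex and no other vertex has `k !` automorphisms. -/
noncomputable def autCard (Γ : PointedDigraph) : ℕ := Nat.card (Iso Γ Γ)

def Iso.refl (Γ : PointedDigraph) : Iso Γ Γ where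
  vert := Equiv.refl _
  edge := Equiv.refl _
  src_edge := by simp
  tgt_edge := by simp

def Iso.symm {Γ Γ' : PointedDigraph} (h : Iso Γ Γ') : Iso Γ' Γ where
  vert := h.vert.symm
  edge := h.edge.symm
  src_edge a := by
    have := h.src_edge (h.edge.symm a)
    rw [Equiv.apply_symm_apply] at this
    simp [this]
  tgt_edge a := by
    have := h.tgt_edge (h.edge.symm a)
    rw [Equiv.apply_symm_apply] at this
    simp [this]

def Iso.trans {Γ Γ' Γ'' : PointedDigraph} (h : Iso Γ Γ') (h' : Iso Γ' Γ'') : Iso Γ Γ'' where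
  vert := h.vert.trans h'.vert
  edge := h.edge.trans h'.edge
  src_edge a := by simp [h.src_edge, h'.src_edge]
  tgt_edge a := by simp [h.tgt_edge, h'.tgt_edge]

instance isoSetoid : Setoid PointedDigraph where
  r Γ Γ' := Nonempty (Iso Γ Γ')
  iseqv :=
    { refl := fun Γ => ⟨Iso.refl Γ⟩
      symm := fun ⟨h⟩ => ⟨h.symm⟩
      trans := fun ⟨h⟩ ⟨h'⟩ => ⟨h.trans h'⟩ }

/-- The edges leaving the vertex `v`. -/
def outEdges (Γ : PointedDigraph) (v : Option (Fin Γ.nV)) : Finset (Fin Γ.nE) :=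
  Finset.univ.filter fun a => Γ.src a = v

/-- The edges entering the vertex `v`. -/
def inEdges (Γ : PointedDigraph) (v : Option (Fin Γ.nV)) : Finset (Fin Γ.nE) :=
  Finset.univ.filter fun a => Γ.tgt a = v

/-- Every ordinary vertex has indegree at least 2 and outdegree at least 2. -/
def IsStable (Γ : PointedDigraph) : Prop :=
  ∀ v : Fin Γ.nV, 2 ≤ (Γ.inEdges (some v)).card ∧ 2 ≤ (Γ.outEdges (some v)).card

/-- There is a directed path from each vertex to every other vertex (the distinguished vertex
included). -/
def IsStronglyConnected (Γ : PointedDigraph) : Prop :=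
  ∀ u v : Option (Fin Γ.nV),
    Relation.ReflTransGen (fun s t => ∃ a, Γ.src a = s ∧ Γ.tgt a = t) u v

/-- The adjacency matrix of the digraph obtained by removing the distinguished vertex. -/
def adjMinus (Γ : PointedDigraph) : Matrix (Fin Γ.nV) (Fin Γ.nV) ℤ :=
  Matrix.of fun u v =>
    ((Finset.univ.filter fun a => Γ.src a = some u ∧ Γ.tgt a = some v).card : ℤ)

end PointedDigraph

/-- The isomorphism classes of pointed digraphs. -/
abbrev GraphClass : Type := Quotient PointedDigraph.isoSetoid

/-- The isomorphism classes of strongly connected pointed stable digraphs of weight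
`|E| - |V| = k`, where `V` is the set of ordinary vertices. -/
def starGraphs (k : ℕ) : Set GraphClass :=
  {c | c.out.IsStable ∧ c.out.IsStronglyConnected ∧ c.out.nE = c.out.nV + k}

/-- There are finitely many such classes, so the sums over `starGraphs k` are genuine finite
sums. -/
theorem starGraphs_finite (k : ℕ) : (starGraphs k).Finite := by
  let T := Σ m : Fin (k + 1), (Fin ((m : ℕ) + k) → Option (Fin (m : ℕ))) ×
    (Fin ((m : ℕ) + k) → Option (Fin (m : ℕ)))
  let F : T → GraphClass := fun t =>
    (Quotient.mk _ (⟨(t.1 : ℕ), (t.1 : ℕ) + k, t.2.1, t.2.2⟩ : PointedDigraph))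
  refine (Set.finite_range F).subset ?_
  rintro c ⟨hs, -, hw⟩
  rw [← Quotient.out_eq c]
  generalize c.out = Γ at hs hw
  obtain ⟨m, e, s, t⟩ := Γ
  simp only at hw
  subst hw
  have hle : m ≤ k := by
    have h1 : ∑ v : Fin m, 2 ≤ ∑ v : Fin m,
        (PointedDigraph.outEdges ⟨m, m + k, s, t⟩ (some v)).card :=
      Finset.sum_le_sum fun v _ => (hs v).2
    have h2 : ∑ v : Option (Fin m),
        (PointedDigraph.outEdges ⟨m, m + k, s, t⟩ v).card = m + k := by
      have := Finset.card_eq_sum_card_fiberwise (s := (Finset.univ : Finset (Fin (m + k))))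
        (t := Finset.univ) (f := s) (by intro x _; simp)
      simpa [PointedDigraph.outEdges] using this.symm
    rw [Fintype.sum_option] at h2
    simp at h1
    omega
  exact ⟨⟨⟨m, by omega⟩, s, t⟩, rfl⟩

/-! ### Wirtinger derivatives on `ℂⁿ` -/

/-- `∂F/∂zᵢ = (∂F/∂xᵢ - √-1 ∂F/∂yᵢ) / 2`. -/
noncomputable def dz {n : ℕ} (i : Fin n) (F : EuclideanSpace ℂ (Fin n) → ℂ) :
    EuclideanSpace ℂ (Fin n) → ℂ := fun z =>
  (fderiv ℝ F z (EuclideanSpace.single i 1)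
    - Complex.I * fderiv ℝ F z (EuclideanSpace.single i Complex.I)) / 2

/-- `∂F/∂z̄ᵢ = (∂F/∂xᵢ + √-1 ∂F/∂yᵢ) / 2`. -/
noncomputable def dzbar {n : ℕ} (i : Fin n) (F : EuclideanSpace ℂ (Fin n) → ℂ) :
    EuclideanSpace ℂ (Fin n) → ℂ := fun z =>
  (fderiv ℝ F z (EuclideanSpace.single i 1)
    + Complex.I * fderiv ℝ F z (EuclideanSpace.single i Complex.I)) / 2

/-- The iterated derivative `∂_{i₁} ⋯ ∂_{iᵣ} F`. -/
noncomputable def dzList {n : ℕ} (L : List (Fin n)) (F : EuclideanSpace ℂ (Fin n) → ℂ) :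
    EuclideanSpace ℂ (Fin n) → ℂ := L.foldr dz F

/-- The iterated derivative `∂̄_{i₁} ⋯ ∂̄_{iᵣ} F`. -/
noncomputable def dzbarList {n : ℕ} (L : List (Fin n)) (F : EuclideanSpace ℂ (Fin n) → ℂ) :
    EuclideanSpace ℂ (Fin n) → ℂ := L.foldr dzbar F

/-! ### Kähler manifolds -/

section Kaehler

variable {n : ℕ} {M : Type*} [TopologicalSpace M] [ChartedSpace (EuclideanSpace ℂ (Fin n)) M]

/-- The coefficient `g_{i j̄}` of a sesquilinear form on the holomorphic tangent spaces in the
holomorphic coordinates `e`, as a function of the coordinates: the value at `(∂ᵢ, ∂ⱼ)`. -/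
noncomputable def metricCoeff
    (form : ∀ x : M, TangentSpace 𝓘(ℂ, EuclideanSpace ℂ (Fin n)) x →ₗ[ℂ]
      TangentSpace 𝓘(ℂ, EuclideanSpace ℂ (Fin n)) x →ₗ⋆[ℂ] ℂ)
    (e : OpenPartialHomeomorph M (EuclideanSpace ℂ (Fin n))) (i j : Fin n) :
    EuclideanSpace ℂ (Fin n) → ℂ := fun z =>
  form (e.symm z)
    (mfderiv 𝓘(ℂ, EuclideanSpace ℂ (Fin n)) 𝓘(ℂ, EuclideanSpace ℂ (Fin n)) e.symm z
      (EuclideanSpace.single i (1 : ℂ) : EuclideanSpace ℂ (Fin n)))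
    (mfderiv 𝓘(ℂ, EuclideanSpace ℂ (Fin n)) 𝓘(ℂ, EuclideanSpace ℂ (Fin n)) e.symm z
      (EuclideanSpace.single j (1 : ℂ) : EuclideanSpace ℂ (Fin n)))

variable (n M) in
/-- A Kähler metric on a complex manifold of dimension `n`: a smooth positive definite Hermitian
form on the holomorphic tangent spaces whose fundamental form `(√-1 / 2π) ∑ g_{i j̄} dzᵢ ∧ dz̄ⱼ` is
closed, that is, `∂ₖ g_{i j̄} = ∂ᵢ g_{k j̄}` in all holomorphic coordinates (the conjugate
equations follow from the Hermitian symmetry). -/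
structure KaehlerMetric where
  form : ∀ x : M, TangentSpace 𝓘(ℂ, EuclideanSpace ℂ (Fin n)) x →ₗ[ℂ]
    TangentSpace 𝓘(ℂ, EuclideanSpace ℂ (Fin n)) x →ₗ⋆[ℂ] ℂ
  conj_form : ∀ (x : M) (v w : TangentSpace 𝓘(ℂ, EuclideanSpace ℂ (Fin n)) x),
    conj (form x v w) = form x w v
  form_pos : ∀ (x : M) (v : TangentSpace 𝓘(ℂ, EuclideanSpace ℂ (Fin n)) x),
    v ≠ 0 → 0 < (form x v v).re
  smooth : ∀ e ∈ IsManifold.maximalAtlas 𝓘(ℂ, EuclideanSpace ℂ (Fin n)) ω M, ∀ i j : Fin n,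
    ContDiffOn ℝ ∞ (metricCoeff form e i j) e.target
  closed : ∀ e ∈ IsManifold.maximalAtlas 𝓘(ℂ, EuclideanSpace ℂ (Fin n)) ω M,
    ∀ z ∈ e.target, ∀ i j k : Fin n,
      dz k (metricCoeff form e i j) z = dz i (metricCoeff form e k j) z

/-- The function `g_{i j̄}` in the coordinates `e`. -/
noncomputable def KaehlerMetric.coeff (g : KaehlerMetric n M)
    (e : OpenPartialHomeomorph M (EuclideanSpace ℂ (Fin n))) (i j : Fin n) :
    EuclideanSpace ℂ (Fin n) → ℂ :=
  metricCoeff g.form e i j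

/-- `e` is a holomorphic coordinate system around `x` which is normal at `x` to order `N`:
`g_{i j̄}(x) = δ_{ij}`, and `g_{i j̄ k₁ … kᵣ}(x) = g_{i j̄ l̄₁ … l̄ᵣ}(x) = 0` for `1 ≤ r ≤ N`. -/
structure KaehlerMetric.IsNormalAt (g : KaehlerMetric n M)
    (e : OpenPartialHomeomorph M (EuclideanSpace ℂ (Fin n))) (x : M) (N : ℕ) : Prop where
  mem_maximalAtlas : e ∈ IsManifold.maximalAtlas 𝓘(ℂ, EuclideanSpace ℂ (Fin n)) ω M
  mem_source : x ∈ e.source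
  coeff_eq : ∀ i j, g.coeff e i j (e x) = if i = j then 1 else 0
  dz_eq_zero : ∀ i j (L : List (Fin n)), 1 ≤ L.length → L.length ≤ N →
    dzList L (g.coeff e i j) (e x) = 0
  dzbar_eq_zero : ∀ i j (L : List (Fin n)), 1 ≤ L.length → L.length ≤ N →
    dzbarList L (g.coeff e i j) (e x) = 0

/-- A choice of normal coordinates around every point. A coordinate system is in general only
normal to a finite (arbitrarily large) order, and the coefficient of `hᵏ` in the star product is
computed in coordinates of order `4 k`. This is enough: a strongly connected pointed stable graph
with `|E| - |V| = k` has `|V| ≤ k` and `|E| ≤ 2 k`, so that no derivative of the metric of order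
above `4 k` occurs. -/
structure KaehlerMetric.NormalCoordinates (g : KaehlerMetric n M) where
  chart : ℕ → M → OpenPartialHomeomorph M (EuclideanSpace ℂ (Fin n))
  isNormalAt : ∀ (k : ℕ) (x : M), g.IsNormalAt (chart k x) x (4 * k)

end Kaehler

/-! ### Partition functions and the star product -/

/-- For unbarred indices `i₁, …, iᵣ` and barred indices `j₁, …, jₛ` with `r, s ≥ 1`, the iterated
derivative `g_{i₁ j̄₁ i₂ … iᵣ j̄₂ … j̄ₛ}`. For a Kähler metric it does not depend on the order of
the unbarred and of the barred indices; the increasing order is used. (The value `0` for `r = 0` or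
`s = 0` never occurs at a vertex of a stable graph.) -/
noncomputable def metricDeriv {n : ℕ} (G : Fin n → Fin n → EuclideanSpace ℂ (Fin n) → ℂ)
    (I J : Multiset (Fin n)) : EuclideanSpace ℂ (Fin n) → ℂ :=
  match I.sort (· ≤ ·), J.sort (· ≤ ·) with
  | i :: I', j :: J' => dzList I' (dzbarList J' (G i j))
  | _, _ => 0

/-- The partition function `D_Γ(F₁, F₂)` at the point `z`. Every edge `a` carries an index
`φ a`, unbarred at its source and barred at its target, over which one sums. An ordinary vertex
contributes the derivative of the metric with all these indices. The distinguished vertex is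
replaced by two vertices `F₁` and `F₂`: its inward edges go to `F₁`, which is differentiated in the
barred directions, and its outward edges to `F₂`, which is differentiated in the unbarred
directions. -/
noncomputable def partitionFunction {n : ℕ} (Γ : PointedDigraph)
    (G : Fin n → Fin n → EuclideanSpace ℂ (Fin n) → ℂ)
    (F₁ F₂ : EuclideanSpace ℂ (Fin n) → ℂ) (z : EuclideanSpace ℂ (Fin n)) : ℂ :=
  ∑ φ : Fin Γ.nE → Fin n,
    (∏ v : Fin Γ.nV,
      metricDeriv G ((Γ.outEdges (some v)).val.map φ) ((Γ.inEdges (some v)).val.map φ) z)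
    * dzbarList (((Γ.inEdges none).val.map φ).sort (· ≤ ·)) F₁ z
    * dzList (((Γ.outEdges none).val.map φ).sort (· ≤ ·)) F₂ z

section Star

variable {n : ℕ} {M : Type*} [TopologicalSpace M] [ChartedSpace (EuclideanSpace ℂ (Fin n)) M]
  {g : KaehlerMetric n M}

/-- The coefficient `Cₖ(f₁, f₂)` of `hᵏ` in the Berezin star product: at `x` it is the sum of
`det (A(Γ₋) - I) / |Aut Γ| · D_Γ(f₁, f₂)` over the (isomorphism classes of) strongly connected
pointed stable graphs `Γ` of weight `k`, computed in normal coordinates around `x`. -/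
noncomputable def starCoeff (ν : g.NormalCoordinates) (k : ℕ) (f₁ f₂ : M → ℂ) : M → ℂ := fun x =>
  ∑ᶠ c ∈ starGraphs k,
    (((c.out.adjMinus - 1).det : ℤ) : ℂ) / (c.out.autCard : ℂ) *
      partitionFunction c.out (g.coeff (ν.chart k x))
        (f₁ ∘ (ν.chart k x).symm) (f₂ ∘ (ν.chart k x).symm) (ν.chart k x x)

/-- The Berezin star product `f₁ ⋆ f₂ = ∑ₖ hᵏ Cₖ(f₁, f₂)` of two functions. -/
noncomputable def starFun (ν : g.NormalCoordinates) (f₁ f₂ : M → ℂ) : PowerSeries (M → ℂ) :=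
  PowerSeries.mk fun k => starCoeff ν k f₁ f₂

/-- The `h`-bilinear extension of the Berezin star product to formal power series in `h`. -/
noncomputable def starSeries (ν : g.NormalCoordinates) (F₁ F₂ : PowerSeries (M → ℂ)) :
    PowerSeries (M → ℂ) :=
  PowerSeries.mk fun m => ∑ p ∈ Finset.HasAntidiagonal.antidiagonal m,
    ∑ q ∈ Finset.HasAntidiagonal.antidiagonal p.2,
    starCoeff ν p.1 (PowerSeries.coeff q.1 F₁) (PowerSeries.coeff q.2 F₂)

end Star

end Berezin

namespace Berezin

namespace PointedDigraph

/-! ### Invariance under isomorphisms -/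

section Iso

variable {Γ Γ' : PointedDigraph}

/-! Conjugation exchanges `∂` with `∂̄` and, by Hermitian symmetry, `g_{i j̄}` with `g_{j ī}`. On a
partition function this has the effect of reversing every edge: the conjugate of `D_Γ(f₁, f₂)` is
`D_{Γ.op}(f̄₂, f̄₁)` (`conj_partitionFunction`). The weight `det(A - I) / |Aut|` is real and does
not see the reversal: `A` becomes its transpose, and the automorphisms are the same pairs of
bijections. Reversal is an involution of each index set `starGraphs k` (`GraphClass.bijOn_op`), so
reindexing by it gives the identity for every `starCoeff`, both sides being computed in the same
chart (`conj_starCoeff`).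

The sum runs over classes with chosen representatives, and `(op c).out` is only isomorphic to
`c.out.op`. This is why every ingredient is shown to be invariant under `Iso`. -/

theorem Iso.map_vert_injective (h : Iso Γ Γ') :
    Function.Injective (Option.map h.vert) :=
  Option.map_injective h.vert.injective

theorem Iso.outEdges_map (h : Iso Γ Γ') (v : Option (Fin Γ.nV)) :
    Γ'.outEdges (v.map h.vert) = (Γ.outEdges v).map h.edge.toEmbedding := by
  ext a
  obtain ⟨b, rfl⟩ := h.edge.surjective a
  simp [outEdges, h.src_edge, h.map_vert_injective.eq_iff]

theorem Iso.inEdges_map (h : Iso Γ Γ') (v : Option (Fin Γ.nV)) :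
    Γ'.inEdges (v.map h.vert) = (Γ.inEdges v).map h.edge.toEmbedding := by
  ext a
  obtain ⟨b, rfl⟩ := h.edge.surjective a
  simp [inEdges, h.tgt_edge, h.map_vert_injective.eq_iff]

theorem Iso.nV_eq (h : Iso Γ Γ') : Γ.nV = Γ'.nV := by
  simpa using Fintype.card_congr h.vert

theorem Iso.nE_eq (h : Iso Γ Γ') : Γ.nE = Γ'.nE := by
  simpa using Fintype.card_congr h.edge

theorem Iso.isStable (h : Iso Γ Γ') (hs : Γ.IsStable) : Γ'.IsStable := by
  intro v
  obtain ⟨u, rfl⟩ := h.vert.surjective v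
  have h1 := h.inEdges_map (some u)
  have h2 := h.outEdges_map (some u)
  simp only [Option.map_some] at h1 h2
  rw [h1, h2, Finset.card_map, Finset.card_map]
  exact hs u

theorem Iso.isStronglyConnected (h : Iso Γ Γ') (hs : Γ.IsStronglyConnected) :
    Γ'.IsStronglyConnected := by
  have hsurj : Function.Surjective (Option.map h.vert) := by
    rintro (_ | v)
    · exact ⟨none, rfl⟩
    · exact ⟨some (h.vert.symm v), by simp⟩
  intro u v
  obtain ⟨u, rfl⟩ := hsurj u
  obtain ⟨v, rfl⟩ := hsurj v
  refine (hs u v).lift _ ?_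
  rintro _ _ ⟨a, rfl, rfl⟩
  exact ⟨h.edge a, h.src_edge a, h.tgt_edge a⟩

theorem Iso.autCard_eq (h : Iso Γ Γ') : Γ.autCard = Γ'.autCard := by
  refine Nat.card_congr
    { toFun := fun s => (h.symm.trans s).trans h
      invFun := fun s => (h.trans s).trans h.symm
      left_inv := fun s => ?_
      right_inv := fun s => ?_ } <;>
  ext <;> simp [Iso.trans, Iso.symm]

theorem Iso.adjMinus_apply (h : Iso Γ Γ') (u v : Fin Γ.nV) :
    Γ'.adjMinus (h.vert u) (h.vert v) = Γ.adjMinus u v := by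
  have key : ∀ (u v : Fin Γ.nV), (Finset.univ.filter fun a =>
      Γ'.src a = some (h.vert u) ∧ Γ'.tgt a = some (h.vert v)) =
      (Finset.univ.filter fun a => Γ.src a = some u ∧ Γ.tgt a = some v).map
        h.edge.toEmbedding := by
    intro u v
    ext a
    obtain ⟨b, rfl⟩ := h.edge.surjective a
    simp [h.src_edge, h.tgt_edge]
  simp [adjMinus, key]

theorem Iso.det_adjMinus_sub_one (h : Iso Γ Γ') :
    (Γ.adjMinus - 1).det = (Γ'.adjMinus - 1).det := by
  rw [← Matrix.det_submatrix_equiv_self h.vert (Γ'.adjMinus - 1)]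
  congr 1
  ext u v
  simp [h.adjMinus_apply, Matrix.one_apply]

/-- Edge labellings are transported along `h.edge`. Each vertex factor depends only on the multisets
of labels at that vertex, which the transport preserves. -/
theorem Iso.partitionFunction_eq {n : ℕ} (h : Iso Γ Γ')
    (G : Fin n → Fin n → EuclideanSpace ℂ (Fin n) → ℂ)
    (F₁ F₂ : EuclideanSpace ℂ (Fin n) → ℂ) (z : EuclideanSpace ℂ (Fin n)) :
    partitionFunction Γ G F₁ F₂ z = partitionFunction Γ' G F₁ F₂ z := by
  have hout (φ : Fin Γ.nE → Fin n) (v : Option (Fin Γ.nV)) :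
      (Γ'.outEdges (v.map h.vert)).val.map (φ ∘ h.edge.symm) = (Γ.outEdges v).val.map φ := by
    rw [h.outEdges_map, Finset.map_val, Multiset.map_map]
    simp [Function.comp_def]
  have hin (φ : Fin Γ.nE → Fin n) (v : Option (Fin Γ.nV)) :
      (Γ'.inEdges (v.map h.vert)).val.map (φ ∘ h.edge.symm) = (Γ.inEdges v).val.map φ := by
    rw [h.inEdges_map, Finset.map_val, Multiset.map_map]
    simp [Function.comp_def]
  refine Fintype.sum_equiv (h.edge.arrowCongr (Equiv.refl _)) _ _ fun φ => ?_
  have hφ : h.edge.arrowCongr (Equiv.refl _) φ = φ ∘ h.edge.symm := rfl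
  rw [hφ]
  congr 1
  · congr 1
    · refine Fintype.prod_equiv h.vert _ _ fun v => ?_
      rw [← hout φ (some v), ← hin φ (some v)]
      rfl
    · rw [← hin φ none]
      rfl
  · rw [← hout φ none]
    rfl

end Iso

/-! ### Reversing the edges -/

/-- The pointed digraph with all edges reversed. -/
def op (Γ : PointedDigraph) : PointedDigraph where
  nV := Γ.nV
  nE := Γ.nE
  src := Γ.tgt
  tgt := Γ.src

def Iso.op {Γ Γ' : PointedDigraph} (h : Iso Γ Γ') : Iso Γ.op Γ'.op where
  vert := h.vert
  edge := h.edge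
  src_edge := h.tgt_edge
  tgt_edge := h.src_edge

theorem IsStable.op {Γ : PointedDigraph} (h : Γ.IsStable) : Γ.op.IsStable :=
  fun v => (h v).symm

theorem IsStronglyConnected.op {Γ : PointedDigraph} (h : Γ.IsStronglyConnected) :
    Γ.op.IsStronglyConnected := by
  intro u v
  have hswap := (h v u).swap
  refine hswap.lift id ?_
  rintro _ _ ⟨a, h₁, h₂⟩
  exact ⟨a, h₂, h₁⟩

theorem autCard_op (Γ : PointedDigraph) : Γ.op.autCard = Γ.autCard :=
  Nat.card_congr ⟨fun h => h.op, fun h => h.op, fun _ => rfl, fun _ => rfl⟩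

theorem adjMinus_op (Γ : PointedDigraph) : Γ.op.adjMinus = Γ.adjMinus.transpose := by
  refine Matrix.ext fun (u v : Fin Γ.nV) => ?_
  change ((Finset.univ.filter fun a => Γ.tgt a = some u ∧ Γ.src a = some v).card : ℤ) =
    ((Finset.univ.filter fun a => Γ.src a = some v ∧ Γ.tgt a = some u).card : ℤ)
  simp only [and_comm]

theorem det_adjMinus_op_sub_one (Γ : PointedDigraph) :
    (Γ.op.adjMinus - 1).det = (Γ.adjMinus - 1).det := by
  rw [← Matrix.det_transpose (Γ.adjMinus - 1), Matrix.transpose_sub, Matrix.transpose_one,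
    ← adjMinus_op]
  -- The two identity matrices are indexed by `Fin Γ.op.nV` and `Fin Γ.nV`, which agree by
  -- definition.
  rfl

end PointedDigraph

/-! ### Reversal as an involution of the summation set -/

namespace GraphClass

/-- Reversing the edges, on isomorphism classes. -/
def op : GraphClass → GraphClass :=
  Quotient.map PointedDigraph.op fun _ _ ⟨h⟩ => ⟨h.op⟩

theorem op_op (c : GraphClass) : op (op c) = c := by
  induction c using Quotient.inductionOn
  rfl

theorem nonempty_iso_out_op (c : GraphClass) :
    Nonempty (PointedDigraph.Iso c.out.op (op c).out) := by
  refine Quotient.exact (s := PointedDigraph.isoSetoid) ?_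
  rw [Quotient.out_eq]
  conv_rhs => rw [← Quotient.out_eq c]
  rfl

theorem op_mem_starGraphs {k : ℕ} {c : GraphClass} (hc : c ∈ starGraphs k) :
    op c ∈ starGraphs k := by
  obtain ⟨hs, hc', hw⟩ := hc
  obtain ⟨h⟩ := nonempty_iso_out_op c
  refine ⟨h.isStable hs.op, h.isStronglyConnected hc'.op, ?_⟩
  rw [← h.nE_eq, ← h.nV_eq]
  exact hw

theorem bijOn_op (k : ℕ) : Set.BijOn op (starGraphs k) (starGraphs k) :=
  Set.InvOn.bijOn (f' := op) ⟨fun c _ => op_op c, fun c _ => op_op c⟩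
    (fun _ => op_mem_starGraphs) (fun _ => op_mem_starGraphs)

end GraphClass

/-! ### Conjugation and Wirtinger derivatives -/

section Wirtinger

variable {n : ℕ}

/-- Conjugation is a real-linear equivalence, so no differentiability is needed: where `F` is not
differentiable, both sides are the default `0`. -/
theorem fderiv_conj_apply (F : EuclideanSpace ℂ (Fin n) → ℂ) (z v : EuclideanSpace ℂ (Fin n)) :
    fderiv ℝ (fun w => conj (F w)) z v = conj (fderiv ℝ F z v) := by
  have := Complex.conjCLE.comp_fderiv (f := F) (x := z)
  exact DFunLike.congr_fun this v

theorem dz_conj (i : Fin n) (F : EuclideanSpace ℂ (Fin n) → ℂ) :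
    dz i (fun w => conj (F w)) = fun w => conj (dzbar i F w) := by
  ext z
  simp [dz, dzbar, fderiv_conj_apply, sub_eq_add_neg, Complex.conj_ofNat]

theorem dzbar_conj (i : Fin n) (F : EuclideanSpace ℂ (Fin n) → ℂ) :
    dzbar i (fun w => conj (F w)) = fun w => conj (dz i F w) := by
  ext z
  simp [dz, dzbar, fderiv_conj_apply, sub_eq_add_neg, Complex.conj_ofNat]

theorem dzList_conj (L : List (Fin n)) (F : EuclideanSpace ℂ (Fin n) → ℂ) :
    dzList L (fun w => conj (F w)) = fun w => conj (dzbarList L F w) := by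
  induction L with
  | nil => rfl
  | cons i L ih =>
    change dz i (dzList L _) = fun w => conj (dzbar i (dzbarList L F) w)
    rw [ih, dz_conj]

theorem dzbarList_conj (L : List (Fin n)) (F : EuclideanSpace ℂ (Fin n) → ℂ) :
    dzbarList L (fun w => conj (F w)) = fun w => conj (dzList L F w) := by
  induction L with
  | nil => rfl
  | cons i L ih =>
    change dzbar i (dzbarList L _) = fun w => conj (dz i (dzList L F) w)
    rw [ih, dzbar_conj]

/-! ### Smoothness and commutation of Wirtinger derivatives on an open set -/

variable {U : Set (EuclideanSpace ℂ (Fin n))} {F F' : EuclideanSpace ℂ (Fin n) → ℂ}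

theorem contDiffOn_fderiv_apply (hU : IsOpen U) (hF : ContDiffOn ℝ ∞ F U)
    (v : EuclideanSpace ℂ (Fin n)) : ContDiffOn ℝ ∞ (fun z => fderiv ℝ F z v) U :=
  (hF.fderiv_of_isOpen hU (by simp)).clm_apply contDiffOn_const

theorem contDiffOn_dz (hU : IsOpen U) (hF : ContDiffOn ℝ ∞ F U) (i : Fin n) :
    ContDiffOn ℝ ∞ (dz i F) U :=
  ((contDiffOn_fderiv_apply hU hF _).sub
    (contDiffOn_const.mul (contDiffOn_fderiv_apply hU hF _))).div_const 2

theorem contDiffOn_dzbar (hU : IsOpen U) (hF : ContDiffOn ℝ ∞ F U) (i : Fin n) :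
    ContDiffOn ℝ ∞ (dzbar i F) U :=
  ((contDiffOn_fderiv_apply hU hF _).add
    (contDiffOn_const.mul (contDiffOn_fderiv_apply hU hF _))).div_const 2

theorem contDiffOn_dzList (hU : IsOpen U) (hF : ContDiffOn ℝ ∞ F U) (L : List (Fin n)) :
    ContDiffOn ℝ ∞ (dzList L F) U := by
  induction L with
  | nil => exact hF
  | cons i L ih => exact contDiffOn_dz hU ih i

theorem eqOn_dz (hU : IsOpen U) (h : Set.EqOn F F' U) (i : Fin n) :
    Set.EqOn (dz i F) (dz i F') U := fun z hz => by
  simp only [dz, (h.eventuallyEq_of_mem (hU.mem_nhds hz)).fderiv_eq]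

theorem eqOn_dzbar (hU : IsOpen U) (h : Set.EqOn F F' U) (i : Fin n) :
    Set.EqOn (dzbar i F) (dzbar i F') U := fun z hz => by
  simp only [dzbar, (h.eventuallyEq_of_mem (hU.mem_nhds hz)).fderiv_eq]

theorem eqOn_dzbarList (hU : IsOpen U) (h : Set.EqOn F F' U) (L : List (Fin n)) :
    Set.EqOn (dzbarList L F) (dzbarList L F') U := by
  induction L with
  | nil => exact h
  | cons i L ih => exact eqOn_dzbar hU ih i

/-- Both sides expand into second real derivatives, and these are symmetric. -/
theorem dz_dzbar_comm (hU : IsOpen U) (hF : ContDiffOn ℝ ∞ F U) (i j : Fin n) :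
    Set.EqOn (dz i (dzbar j F)) (dzbar j (dz i F)) U := by
  intro z hz
  have hz' := hU.mem_nhds hz
  have hFz : ContDiffAt ℝ ∞ F z := hF.contDiffAt hz'
  have hsymm : IsSymmSndFDerivAt ℝ F z := hFz.isSymmSndFDerivAt (by
    rw [minSmoothness_of_isRCLikeNormedField]; exact WithTop.coe_le_coe.2 le_top)
  have hd : DifferentiableAt ℝ (fderiv ℝ F) z :=
    (hFz.fderiv_right (m := ∞) (by simp)).differentiableAt (by simp)
  have hda (v : EuclideanSpace ℂ (Fin n)) :
      HasFDerivAt (fun w => fderiv ℝ F w v) ((fderiv ℝ (fderiv ℝ F) z).flip v) z :=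
    ((ContinuousLinearMap.apply ℝ ℂ v).hasFDerivAt.comp z hd.hasFDerivAt)
  have h1 : ∀ v, fderiv ℝ (dzbar j F) z v =
      (fderiv ℝ (fderiv ℝ F) z v (EuclideanSpace.single j 1)
        + Complex.I * fderiv ℝ (fderiv ℝ F) z v (EuclideanSpace.single j Complex.I)) / 2 := by
    intro v
    have := (((hda (EuclideanSpace.single j 1)).add
      ((hda (EuclideanSpace.single j Complex.I)).const_mul Complex.I)).mul_const (2 : ℂ)⁻¹)
    have h2 : dzbar j F = fun w => (fderiv ℝ F w (EuclideanSpace.single j 1)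
      + Complex.I * fderiv ℝ F w (EuclideanSpace.single j Complex.I)) * (2 : ℂ)⁻¹ := by
      ext w; simp [dzbar, div_eq_mul_inv]
    rw [h2]
    refine (DFunLike.congr_fun (HasFDerivAt.fderiv this) v).trans ?_
    simp
    ring
  have h1' : ∀ v, fderiv ℝ (dz i F) z v =
      (fderiv ℝ (fderiv ℝ F) z v (EuclideanSpace.single i 1)
        - Complex.I * fderiv ℝ (fderiv ℝ F) z v (EuclideanSpace.single i Complex.I)) / 2 := by
    intro v
    have := (((hda (EuclideanSpace.single i 1)).sub
      ((hda (EuclideanSpace.single i Complex.I)).const_mul Complex.I)).mul_const (2 : ℂ)⁻¹)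
    have h2 : dz i F = fun w => (fderiv ℝ F w (EuclideanSpace.single i 1)
      - Complex.I * fderiv ℝ F w (EuclideanSpace.single i Complex.I)) * (2 : ℂ)⁻¹ := by
      ext w; simp [dz, div_eq_mul_inv]
    rw [h2]
    refine (DFunLike.congr_fun (HasFDerivAt.fderiv this) v).trans ?_
    simp
    ring
  rw [dz, dzbar, h1, h1, h1', h1',
    hsymm.eq (EuclideanSpace.single i 1) (EuclideanSpace.single j 1),
    hsymm.eq (EuclideanSpace.single i 1) (EuclideanSpace.single j Complex.I),
    hsymm.eq (EuclideanSpace.single i Complex.I) (EuclideanSpace.single j 1),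
    hsymm.eq (EuclideanSpace.single i Complex.I) (EuclideanSpace.single j Complex.I)]
  ring

theorem dzList_dzbar_comm (hU : IsOpen U) (hF : ContDiffOn ℝ ∞ F U) (I : List (Fin n))
    (j : Fin n) : Set.EqOn (dzList I (dzbar j F)) (dzbar j (dzList I F)) U := by
  induction I with
  | nil => exact Set.eqOn_refl _ _
  | cons i I ih =>
    exact (eqOn_dz hU ih i).trans (dz_dzbar_comm hU (contDiffOn_dzList hU hF I) i j)

theorem contDiffOn_dzbarList (hU : IsOpen U) (hF : ContDiffOn ℝ ∞ F U) (L : List (Fin n)) :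
    ContDiffOn ℝ ∞ (dzbarList L F) U := by
  induction L with
  | nil => exact hF
  | cons i L ih => exact contDiffOn_dzbar hU ih i

/-- `metricDeriv` applies the barred derivatives before the unbarred ones, and conjugation inverts
that order; this lemma restores it. -/
theorem dzList_dzbarList_comm (hU : IsOpen U) (hF : ContDiffOn ℝ ∞ F U) (I J : List (Fin n)) :
    Set.EqOn (dzList I (dzbarList J F)) (dzbarList J (dzList I F)) U := by
  induction J with
  | nil => exact Set.eqOn_refl _ _
  | cons j J ih =>
    exact (dzList_dzbar_comm hU (contDiffOn_dzbarList hU hF J) I j).trans (eqOn_dzbar hU ih j)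

/-! ### Conjugation of partition functions -/

variable {G : Fin n → Fin n → EuclideanSpace ℂ (Fin n) → ℂ}

theorem conj_metricDeriv (hU : IsOpen U) (hG : ∀ i j, ContDiffOn ℝ ∞ (G i j) U)
    (hconj : ∀ i j z, conj (G i j z) = G j i z) (I J : Multiset (Fin n))
    {z : EuclideanSpace ℂ (Fin n)} (hz : z ∈ U) :
    conj (metricDeriv G I J z) = metricDeriv G J I z := by
  unfold metricDeriv
  -- If either list is empty, both sides take the default value `0`.
  rcases I.sort (· ≤ ·) with _ | ⟨i, I'⟩ <;> rcases J.sort (· ≤ ·) with _ | ⟨j, J'⟩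
  · simp
  · simp
  · simp
  · have h : G i j = fun w => conj (G j i w) := by
      ext w
      rw [hconj]
    change conj (dzList I' (dzbarList J' (G i j)) z) = dzList J' (dzbarList I' (G j i)) z
    rw [h, dzbarList_conj, dzList_conj, Complex.conj_conj]
    exact (dzList_dzbarList_comm hU (hG j i) J' I' hz).symm

theorem conj_partitionFunction (hU : IsOpen U) (hG : ∀ i j, ContDiffOn ℝ ∞ (G i j) U)
    (hconj : ∀ i j z, conj (G i j z) = G j i z) (Γ : PointedDigraph)
    (F₁ F₂ : EuclideanSpace ℂ (Fin n) → ℂ) {z : EuclideanSpace ℂ (Fin n)} (hz : z ∈ U) :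
    conj (partitionFunction Γ G F₁ F₂ z) =
      partitionFunction Γ.op G (fun w => conj (F₂ w)) (fun w => conj (F₁ w)) z := by
  unfold partitionFunction
  rw [map_sum]
  refine Finset.sum_congr rfl fun φ _ => ?_
  -- The labelling `φ` is kept. Incoming edges of `Γ.op` are by definition outgoing edges of `Γ`, so
  -- once the two factors at the distinguished vertex are swapped the products match factor by
  -- factor.
  rw [map_mul, map_mul, map_prod, dzbarList_conj, dzList_conj, mul_right_comm]
  congr 2
  exact Finset.prod_congr rfl fun v _ => conj_metricDeriv hU hG hconj _ _ hz

end Wirtinger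

/-! ### Conjugation of the star product -/

section Star

variable {n : ℕ} {M : Type*} [TopologicalSpace M] [ChartedSpace (EuclideanSpace ℂ (Fin n)) M]
  {g : KaehlerMetric n M}

theorem KaehlerMetric.conj_coeff (g : KaehlerMetric n M)
    (e : OpenPartialHomeomorph M (EuclideanSpace ℂ (Fin n))) (i j : Fin n)
    (z : EuclideanSpace ℂ (Fin n)) : conj (g.coeff e i j z) = g.coeff e j i z :=
  g.conj_form _ _ _

theorem conj_starCoeff (ν : g.NormalCoordinates) (k : ℕ) (f₁ f₂ : M → ℂ) :
    starRingEnd (M → ℂ) (starCoeff ν k f₁ f₂) =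
      starCoeff ν k (starRingEnd (M → ℂ) f₂) (starRingEnd (M → ℂ) f₁) := by
  ext x
  have hν := ν.isNormalAt k x
  change conj (starCoeff ν k f₁ f₂ x) = _
  unfold starCoeff
  -- Finiteness of `starGraphs k` is what lets conjugation pass through the `finsum`.
  have hmap := (starRingEnd ℂ).toAddMonoidHom.map_finsum_mem
    (fun c : GraphClass => (((c.out.adjMinus - 1).det : ℤ) : ℂ) / (c.out.autCard : ℂ) *
      partitionFunction c.out (g.coeff (ν.chart k x))
        (f₁ ∘ (ν.chart k x).symm) (f₂ ∘ (ν.chart k x).symm) (ν.chart k x x))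
    (starGraphs_finite k)
  refine hmap.trans (finsum_mem_eq_of_bijOn GraphClass.op (GraphClass.bijOn_op k) fun c _ => ?_)
  obtain ⟨h⟩ := GraphClass.nonempty_iso_out_op c
  -- The chosen representative of `op c` is traded for `c.out.op`.
  rw [← h.det_adjMinus_sub_one, ← h.autCard_eq, ← h.partitionFunction_eq,
    PointedDigraph.det_adjMinus_op_sub_one, PointedDigraph.autCard_op]
  change conj (_ * _) = _
  rw [map_mul, map_div₀, Complex.conj_natCast, map_intCast,
    conj_partitionFunction (ν.chart k x).open_target
      (G := g.coeff (ν.chart k x)) (g.smooth _ hν.mem_maximalAtlas) (g.conj_coeff _) _ _ _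
      ((ν.chart k x).map_source hν.mem_source)]
  rfl

end Star

end Berezin



theorem proposition3p8 {n : ℕ} {M : Type*} [TopologicalSpace M]
    [ChartedSpace (EuclideanSpace ℂ (Fin n)) M]
    [IsManifold 𝓘(ℂ, EuclideanSpace ℂ (Fin n)) ω M]
    (g : Berezin.KaehlerMetric n M) (ν : g.NormalCoordinates) :
    (∀ f₁ f₂ : M → ℂ,
      ContMDiff 𝓘(ℝ, EuclideanSpace ℂ (Fin n)) 𝓘(ℝ, ℂ) ∞ f₁ →
      ContMDiff 𝓘(ℝ, EuclideanSpace ℂ (Fin n)) 𝓘(ℝ, ℂ) ∞ f₂ →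
      PowerSeries.map (starRingEnd (M → ℂ)) (Berezin.starFun ν f₁ f₂) =
        Berezin.starFun ν (fun x => conj (f₂ x)) (fun x => conj (f₁ x))) ∧
    (∀ F₁ F₂ : PowerSeries (M → ℂ),
      (∀ k, ContMDiff 𝓘(ℝ, EuclideanSpace ℂ (Fin n)) 𝓘(ℝ, ℂ) ∞ (PowerSeries.coeff k F₁)) →
      (∀ k, ContMDiff 𝓘(ℝ, EuclideanSpace ℂ (Fin n)) 𝓘(ℝ, ℂ) ∞ (PowerSeries.coeff k F₂)) →
      PowerSeries.map (starRingEnd (M → ℂ)) (Berezin.starSeries ν F₁ F₂) =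
        Berezin.starSeries ν (PowerSeries.map (starRingEnd (M → ℂ)) F₂)
          (PowerSeries.map (starRingEnd (M → ℂ)) F₁)) := by
  refine ⟨fun f₁ f₂ _ _ => ?_, fun F₁ F₂ _ _ => ?_⟩
  · ext1 k
    simp only [PowerSeries.coeff_map, Berezin.starFun, PowerSeries.coeff_mk]
    exact Berezin.conj_starCoeff ν k f₁ f₂
  · ext1 m
    simp only [PowerSeries.coeff_map, Berezin.starSeries, PowerSeries.coeff_mk, map_sum,
      Berezin.conj_starCoeff]
    refine Finset.sum_congr rfl fun p _ => ?_
    -- Interchanging the two series swaps the exponents `q.1` and `q.2`; the exponent `p.1` coming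
    -- from the star product stays fixed.
    exact (Finset.Nat.sum_antidiagonal_swap (n := p.2)
      (f := fun q => Berezin.starCoeff ν p.1 (starRingEnd (M → ℂ) (PowerSeries.coeff q.2 F₂))
        (starRingEnd (M → ℂ) (PowerSeries.coeff q.1 F₁)))).symm
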